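/- Let $\Delta\ge 1$ and $q\ge 1$ be integers, and put $\nu=0.9$, $\epsilon_I=10^{-4}\Delta^{-4}$. Let $R$ be a real number with $$0<R\le \frac{\nu\,\epsilon_I}{4}=2.25\times 10^{-5}\,\Delta^{-4}.$$ 1. If $\vec\lambda\in\mathbb C^q$ satisfies $|\lambda_i-1|\le R$ for every $i\in\{1,\dots,q\}$, then for all $i,j\in\{1,\dots,q\}$ we have $\lambda_i\notin(-\infty,0]$, $|\arg\lambda_i|\le \nu\epsilon_I/2$ and $\left|\operatorname{Re}\ln(\lambda_i/\lambda_j)\right|\le\Delta\,\epsilon_I$, where $\ln$ and $\arg$ denote the principal branches. 2. Suppose $q\ge 2\Delta$. For a finite simple graph $G=(V,E)$ let $$Z_G(\vec\lambda)=\sum_{\substack{\sigma:V\to\{1,\dots,q\}\\ \sigma\text{ proper}}}\ \prod_{i=1}^q\lambda_i^{|\sigma^{-1}(i)|}$$ be the partition function of the $q$-coloring model with external fields, where $\sigma$ is proper if $\sigma(u)\ne\sigma(v)$ for every edge $uv\in E$. If $G$ has maximum degree at most $\Delta$, then $Z_G(\vec\lambda)\ne0$ for every $\vec\lambda\in\mathbb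 C^q$ with $|\lambda_i-1|\le R$ for every $i$. In other words, $Z_G$ is zero-free on the closed $\ell_\infty$ polydisc of radius $R$ around $\vec 1=(1,\dots,1)$; in particular this holds for $R=\nu\epsilon_I/4$. -/

import Mathlib

namespace ColoringModel

/-- The constant `ν = 0.9`. -/
noncomputable def nu : ℝ := 9 / 10

/-- The constant `ε_I = 10⁻⁴ Δ⁻⁴`. -/
noncomputable def epsI (Δ : ℕ) : ℝ := 1 / (10 ^ 4 * (Δ : ℝ) ^ 4)

/-- The radius `ν ε_I / 4` of zero-freeness. -/
noncomputable def zeroFreeRadius (Δ : ℕ) : ℝ := nu * epsI Δ / 4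

/-- The exact numerical value `2.25 · 10⁻⁵ Δ⁻⁴` of the radius. -/
theorem zeroFreeRadius_eq (Δ : ℕ) :
    zeroFreeRadius Δ = 2.25 * (10 : ℝ) ^ (-5 : ℤ) * (Δ : ℝ) ^ (-4 : ℤ) := by
  have h : ((Δ : ℝ)) ^ (-4 : ℤ) = 1 / (Δ : ℝ) ^ 4 := by
    rw [zpow_neg, one_div]; norm_cast
  rw [h, zeroFreeRadius, nu, epsI, one_div, one_div, mul_inv]
  norm_num
  ring

/-- The standing assumptions on the fugacity vector `lam ∈ ℂ^q` (relative to `Δ`):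
no entry lies on `(-∞, 0]`, the arguments are at most `ν ε_I / 2` in absolute value, and
`|Re ln (lam i / lam j)| ≤ Δ ε_I`, where `ln` and `arg` are the principal branches. -/
structure IsValid (Δ : ℕ) {q : ℕ} (lam : Fin q → ℂ) : Prop where
  mem_slitPlane : ∀ i, lam i ∈ Complex.slitPlane
  abs_arg_le : ∀ i, |(lam i).arg| ≤ nu * epsI Δ / 2
  abs_re_log_div_le : ∀ i j, |(Complex.log (lam i / lam j)).re| ≤ (Δ : ℝ) * epsI Δ

open scoped Classical in
/-- The partition function of the coloring model with external fields:
the sum over all proper colorings `σ : V → [q]` of `∏ i, (lam i) ^ |σ⁻¹(i)|`. -/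
noncomputable def partitionFunction {V : Type*} [Fintype V] (G : SimpleGraph V) {q : ℕ}
    (lam : Fin q → ℂ) : ℂ :=
  ∑ σ : V → Fin q with ∀ u v, G.Adj u v → σ u ≠ σ v,
    ∏ i : Fin q, lam i ^ (Finset.univ.filter fun v => σ v = i).card

end ColoringModel

/-! Zero-freeness is proved for list colorings of the subgraphs induced on vertex sets `S`, where
each list has at least `Δ` more colors than its vertex has neighbors in `S`; `q ≥ 2Δ` puts the
original instance in this class. Dividing by the number of colorings gives `ratio`, and coloring one
vertex `u` writes the ratio as a convex average, over colors `c` in the list of `u`, of `lam c`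
times the ratio on `S.erase u` with `c` erased from the lists of the neighbors. The weights are
genuine counts, hence positive, so the average is nonzero as soon as the averaged values are close
to each other.

Closeness comes from the induction hypothesis `Stable`: if a list has a color to spare, then erasing
`i` from it rather than `j` changes the ratio by a factor within `exp ε - 1` of `1`, with `ε = 1 /
(100 Δ²)`. Passing through the `d` neighbors of `u` one at a time shows that the averaged values
agree up to `δ = exp (κ + d ε) - 1`, where `κ` bounds the spread of the fields.

The hypothesis reproduces itself because, with a color to spare at `u`, each color has probability
at most `1 / (Δ + 1)` at `u`. Erasing `i` or `j` from the average then moves it by only `1 / Δ` of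
the spread, and as `d ≤ Δ - 1` here, roughly `(κ + (Δ - 1) ε) / Δ ≤ ε` is needed.

The bounds on `arg` and `log` are independent of this and follow from `‖log z‖ ≤ 2R` near `1`. -/

namespace ColoringModel

/-! ### List colorings of induced subgraphs: recursion and counting. -/

section ListColorings

open scoped Classical

variable {V C : Type*}

/-- Remove the color `c` from the lists of all vertices in `T`. -/
noncomputable def eraseOn (T : Finset V) (c : C) (L : V → Finset C) : V → Finset C :=
  fun v => if v ∈ T then (L v).erase c else L v

/-- The neighbors of `v` in the set `S`. -/
noncomputable def nbrs (G : SimpleGraph V) (S : Finset V) (v : V) : Finset V :=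
  S.filter fun w => G.Adj v w

theorem mem_nbrs {G : SimpleGraph V} {S : Finset V} {v w : V} :
    w ∈ nbrs G S v ↔ w ∈ S ∧ G.Adj v w := by
  simp [nbrs]

theorem eraseOn_insert (T : Finset V) (u : V) (c : C) (L : V → Finset C) :
    eraseOn (insert u T) c L = eraseOn {u} c (eraseOn T c L) := by
  funext v
  by_cases h1 : v = u <;> by_cases h2 : v ∈ T <;> simp [eraseOn, h1, h2] <;>
    (subst h1; simp [h2])

theorem eraseOn_comm (T T' : Finset V) (c c' : C) (L : V → Finset C) :
    eraseOn T c (eraseOn T' c' L) = eraseOn T' c' (eraseOn T c L) := by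
  funext v
  by_cases h1 : v ∈ T <;> by_cases h2 : v ∈ T' <;> simp [eraseOn, h1, h2, Finset.erase_right_comm]

theorem nbrs_subset_erase (G : SimpleGraph V) (S : Finset V) (u : V) :
    nbrs G S u ⊆ S.erase u := fun _ hw =>
  Finset.mem_erase.2 ⟨(mem_nbrs.1 hw).2.ne', (mem_nbrs.1 hw).1⟩

variable [Fintype V] [Fintype C] [Inhabited C]

/-- The proper list colorings of the subgraph induced on `S`, extended by a default color. -/
noncomputable def listColorings (G : SimpleGraph V) (S : Finset V) (L : V → Finset C) :
    Finset (V → C) :=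
  Finset.univ.filter fun σ => (∀ v ∈ S, σ v ∈ L v) ∧ (∀ v ∉ S, σ v = default) ∧
    ∀ u ∈ S, ∀ v ∈ S, G.Adj u v → σ u ≠ σ v

/-- The weighted number of proper list colorings of the subgraph induced on `S`. -/
noncomputable def listSum {R : Type*} [CommSemiring R] (G : SimpleGraph V) (lam : C → R)
    (S : Finset V) (L : V → Finset C) : R :=
  ∑ σ ∈ listColorings G S L, ∏ v ∈ S, lam (σ v)

theorem mem_listColorings {G : SimpleGraph V} {S : Finset V} {L : V → Finset C} {σ : V → C} :
    σ ∈ listColorings G S L ↔ (∀ v ∈ S, σ v ∈ L v) ∧ (∀ v ∉ S, σ v = default) ∧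
      ∀ u ∈ S, ∀ v ∈ S, G.Adj u v → σ u ≠ σ v := by
  simp [listColorings]

theorem listSum_empty {R : Type*} [CommSemiring R] (G : SimpleGraph V) (lam : C → R)
    (L : V → Finset C) : listSum G lam ∅ L = 1 := by
  have : listColorings G ∅ L = {fun _ => default} := by
    ext σ
    simp [mem_listColorings, funext_iff]
  simp [listSum, this]

theorem listSum_eq_sum_erase {R : Type*} [CommSemiring R] (G : SimpleGraph V) (lam : C → R)
    {S : Finset V} {u : V} (hu : u ∈ S) (L : V → Finset C) :
    listSum G lam S L =
      ∑ c ∈ L u, lam c * listSum G lam (S.erase u) (eraseOn (nbrs G S u) c L) := by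
  unfold listSum
  rw [← Finset.sum_fiberwise_of_maps_to (s := listColorings G S L) (t := L u)
    (g := fun σ => σ u) (fun σ hσ => (mem_listColorings.1 hσ).1 u hu)]
  refine Finset.sum_congr rfl fun c hc => ?_
  rw [Finset.mul_sum]
  -- Colorings take the default value outside their vertex set, so forgetting the color of `u` means
  -- resetting it to `default`; the inverse restores `c`.
  refine Finset.sum_nbij' (fun σ => Function.update σ u default)
    (fun σ => Function.update σ u c) ?_ ?_ ?_ ?_ ?_
  · intro σ hσ
    obtain ⟨hσ', rfl⟩ := Finset.mem_filter.1 hσ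
    obtain ⟨h1, h2, h3⟩ := mem_listColorings.1 hσ'
    refine mem_listColorings.2 ⟨?_, ?_, ?_⟩
    · intro v hv
      obtain ⟨hvu, hv⟩ := Finset.mem_erase.1 hv
      rw [Function.update_of_ne hvu]
      unfold eraseOn
      split_ifs with h
      · exact Finset.mem_erase.2 ⟨(h3 u hu v hv (mem_nbrs.1 h).2).symm, h1 v hv⟩
      · exact h1 v hv
    · intro v hv
      by_cases hvu : v = u
      · subst hvu; simp
      · rw [Function.update_of_ne hvu]
        exact h2 v fun h => hv (Finset.mem_erase.2 ⟨hvu, h⟩)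
    · intro v hv w hw hvw
      obtain ⟨hvu, hv⟩ := Finset.mem_erase.1 hv
      obtain ⟨hwu, hw⟩ := Finset.mem_erase.1 hw
      rw [Function.update_of_ne hvu, Function.update_of_ne hwu]
      exact h3 v hv w hw hvw
  · intro σ hσ
    obtain ⟨h1, h2, h3⟩ := mem_listColorings.1 hσ
    have key : ∀ v ∈ S, v ≠ u → G.Adj u v → σ v ≠ c := by
      intro v hv hvu h
      have := h1 v (Finset.mem_erase.2 ⟨hvu, hv⟩)
      rw [eraseOn, if_pos (mem_nbrs.2 ⟨hv, h⟩)] at this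
      exact (Finset.mem_erase.1 this).1
    refine Finset.mem_filter.2 ⟨mem_listColorings.2 ⟨?_, ?_, ?_⟩, by simp⟩
    · intro v hv
      by_cases hvu : v = u
      · subst hvu; simpa using hc
      · rw [Function.update_of_ne hvu]
        have := h1 v (Finset.mem_erase.2 ⟨hvu, hv⟩)
        unfold eraseOn at this
        split_ifs at this
        · exact Finset.mem_of_mem_erase this
        · exact this
    · intro v hv
      have hvu : v ≠ u := fun h => hv (h ▸ hu)
      rw [Function.update_of_ne hvu]
      exact h2 v fun h => hv (Finset.mem_of_mem_erase h)
    · intro v hv w hw hvw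
      by_cases hvu : v = u
      · subst hvu
        have hwv : w ≠ v := hvw.ne'
        rw [Function.update_self, Function.update_of_ne hwv]
        exact (key w hw hwv hvw).symm
      · by_cases hwu : w = u
        · subst hwu
          rw [Function.update_self, Function.update_of_ne hvu]
          exact key v hv hvu hvw.symm
        · rw [Function.update_of_ne hvu, Function.update_of_ne hwu]
          exact h3 v (Finset.mem_erase.2 ⟨hvu, hv⟩) w (Finset.mem_erase.2 ⟨hwu, hw⟩) hvw
  · intro σ hσ
    obtain ⟨-, rfl⟩ := Finset.mem_filter.1 hσ
    simp
  · intro σ hσ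
    have := (mem_listColorings.1 hσ).2.1 u (Finset.notMem_erase u S)
    simp [← this]
  · intro σ hσ
    obtain ⟨-, rfl⟩ := Finset.mem_filter.1 hσ
    rw [← Finset.mul_prod_erase S _ hu]
    congr 1
    refine Finset.prod_congr rfl fun v hv => ?_
    rw [Function.update_of_ne (Finset.ne_of_mem_erase hv)]

/-- The number of proper list colorings of the subgraph induced on `S`. -/
noncomputable def listCount (G : SimpleGraph V) (S : Finset V) (L : V → Finset C) : ℕ :=
  (listColorings G S L).card

theorem listSum_one {R : Type*} [CommSemiring R] (G : SimpleGraph V) (S : Finset V)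
    (L : V → Finset C) : listSum G (fun _ => (1 : R)) S L = listCount G S L := by
  simp [listSum, listCount]

theorem listCount_eq_sum_erase (G : SimpleGraph V) {S : Finset V} {u : V} (hu : u ∈ S)
    (L : V → Finset C) :
    listCount G S L = ∑ c ∈ L u, listCount G (S.erase u) (eraseOn (nbrs G S u) c L) := by
  have h := listSum_eq_sum_erase G (fun _ : C => (1 : ℕ)) hu L
  simpa only [listSum_one, one_mul, Nat.cast_id] using h

theorem listColorings_eraseOn (G : SimpleGraph V) {S T : Finset V} (hT : T ⊆ S)
    (c : C) (L : V → Finset C) :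
    listColorings G S (eraseOn T c L) =
      (listColorings G S L).filter fun σ => ∀ w ∈ T, σ w ≠ c := by
  ext σ
  rw [Finset.mem_filter, mem_listColorings, mem_listColorings]
  constructor
  · rintro ⟨h1, h2, h3⟩
    refine ⟨⟨fun v hv => ?_, h2, h3⟩, fun w hw => ?_⟩
    · have := h1 v hv
      unfold eraseOn at this
      split_ifs at this
      · exact Finset.mem_of_mem_erase this
      · exact this
    · have := h1 w (hT hw)
      rw [eraseOn, if_pos hw] at this
      exact Finset.ne_of_mem_erase this
  · rintro ⟨⟨h1, h2, h3⟩, h4⟩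
    refine ⟨fun v hv => ?_, h2, h3⟩
    unfold eraseOn
    split_ifs with h
    · exact Finset.mem_erase.2 ⟨h4 v h, h1 v hv⟩
    · exact h1 v hv

theorem listCount_eraseOn_le (G : SimpleGraph V) {S T : Finset V} (hT : T ⊆ S)
    (c : C) (L : V → Finset C) : listCount G S (eraseOn T c L) ≤ listCount G S L := by
  unfold listCount
  rw [listColorings_eraseOn G hT]
  exact Finset.card_filter_le _ _

/-- Double counting: a coloring of `S.erase u` blocks at most one color per neighbor of `u`, so at
least `m` colors extend it. With `listCount_eraseOn_le` this bounds each color's probability at `u`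
by `1 / m`. -/
theorem mul_listCount_erase_le (G : SimpleGraph V) {S : Finset V} {u : V} (hu : u ∈ S)
    (L : V → Finset C) {m : ℕ} (hm : (nbrs G S u).card + m ≤ (L u).card) :
    m * listCount G (S.erase u) L ≤ listCount G S L := by
  rw [listCount_eq_sum_erase G hu]
  unfold listCount
  simp_rw [listColorings_eraseOn G (nbrs_subset_erase G S u)]
  change _ ≤ ∑ c ∈ L u, ((listColorings G (S.erase u) L).bipartiteBelow
    (fun σ c => ∀ w ∈ nbrs G S u, σ w ≠ c) c).card
  rw [← Finset.sum_card_bipartiteAbove_eq_sum_card_bipartiteBelow, mul_comm]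
  refine Finset.card_nsmul_le_sum _ _ _ fun σ _ => ?_
  have : L u \ (nbrs G S u).image σ ⊆
      (L u).bipartiteAbove (fun σ c => ∀ w ∈ nbrs G S u, σ w ≠ c) σ := by
    intro c hc
    simp only [Finset.mem_sdiff, Finset.mem_image, not_exists, not_and] at hc
    simp only [Finset.bipartiteAbove, Finset.mem_filter]
    exact ⟨hc.1, hc.2⟩
  have h1 := Finset.card_le_card this
  have h2 := Finset.le_card_sdiff ((nbrs G S u).image σ) (L u)
  have h3 := Finset.card_image_le (s := nbrs G S u) (f := σ)
  omega

end ListColorings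

/-! ### Weighted averages of complex numbers and their sensitivity to removing one color. -/

section Averages

/-- Measuring distance from `1` as `exp s - 1` makes the errors of a product add up in the exponent.
-/
theorem norm_mul_sub_one_le {w z : ℂ} {s t : ℝ} (hw : ‖w - 1‖ ≤ Real.exp s - 1)
    (hz : ‖z - 1‖ ≤ Real.exp t - 1) : ‖w * z - 1‖ ≤ Real.exp (s + t) - 1 := by
  have h1 : w * z - 1 = (w - 1) * (z - 1) + ((w - 1) + (z - 1)) := by ring
  have h2 : ‖(w - 1) * (z - 1)‖ ≤ (Real.exp s - 1) * (Real.exp t - 1) := by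
    rw [norm_mul]
    exact mul_le_mul hw hz (norm_nonneg _) ((norm_nonneg _).trans hw)
  rw [h1, Real.exp_add]
  nlinarith [norm_add_le ((w - 1) * (z - 1)) ((w - 1) + (z - 1)),
    norm_add_le (w - 1) (z - 1)]

variable {C : Type*}

/-- The average of `ρ` over `A` with weights `y`. -/
noncomputable def average (A : Finset C) (y : C → ℝ) (ρ : C → ℂ) : ℂ :=
  (∑ l ∈ A, (y l : ℂ) * ρ l) / ((∑ l ∈ A, y l : ℝ) : ℂ)

theorem norm_average_sub_le {A : Finset C} {y : C → ℝ} {ρ : C → ℂ} (hy : ∀ l ∈ A, 0 ≤ y l)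
    (hpos : 0 < ∑ l ∈ A, y l) {z : ℂ} {M : ℝ} (h : ∀ l ∈ A, ‖ρ l - z‖ ≤ M) :
    ‖average A y ρ - z‖ ≤ M := by
  have hne : ((∑ l ∈ A, y l : ℝ) : ℂ) ≠ 0 := by exact_mod_cast hpos.ne'
  have h1 : average A y ρ - z = (∑ l ∈ A, (y l : ℂ) * (ρ l - z)) / ((∑ l ∈ A, y l : ℝ) : ℂ) := by
    rw [average, eq_div_iff hne, sub_mul, div_mul_cancel₀ _ hne]
    simp only [mul_sub, Finset.sum_sub_distrib, ← Finset.sum_mul]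
    push_cast
    ring
  rw [h1, norm_div, Complex.norm_real, Real.norm_of_nonneg hpos.le, div_le_iff₀ hpos,
    Finset.mul_sum]
  refine (norm_sum_le _ _).trans (Finset.sum_le_sum fun l hl => ?_)
  rw [norm_mul, Complex.norm_real, Real.norm_of_nonneg (hy l hl), mul_comm]
  exact mul_le_mul_of_nonneg_right (h l hl) (hy l hl)

theorem average_ne_zero {A : Finset C} {y : C → ℝ} {ρ : C → ℂ} (hy : ∀ l ∈ A, 0 ≤ y l)
    (hpos : 0 < ∑ l ∈ A, y l) (hρ : ∀ l ∈ A, ρ l ≠ 0) {δ : ℝ} (hδ : δ < 1)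
    (h : ∀ l ∈ A, ∀ m ∈ A, ‖ρ l - ρ m‖ ≤ δ * ‖ρ m‖) : average A y ρ ≠ 0 := by
  obtain ⟨m, hm⟩ : A.Nonempty := by
    rw [Finset.nonempty_iff_ne_empty]
    rintro rfl
    simp at hpos
  intro h0
  have h1 := norm_average_sub_le hy hpos fun l hl => h l hl m hm
  rw [h0, zero_sub, norm_neg] at h1
  nlinarith [norm_pos_iff.2 (hρ m hm)]

/-- Removing one color changes an average by the odds of this color times the deviation. -/
theorem average_erase_sub [DecidableEq C] {A : Finset C} {y : C → ℝ} (ρ : C → ℂ) {i : C}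
    (hpos : 0 < ∑ l ∈ A, y l) (hi : i ∈ A) (hpos' : 0 < ∑ l ∈ A.erase i, y l) :
    average (A.erase i) y ρ - average A y ρ =
      ((y i / ∑ l ∈ A.erase i, y l : ℝ) : ℂ) * (average A y ρ - ρ i) := by
  have hne : ((∑ l ∈ A, y l : ℝ) : ℂ) ≠ 0 := by exact_mod_cast hpos.ne'
  have hne' : ((∑ l ∈ A.erase i, y l : ℝ) : ℂ) ≠ 0 := by exact_mod_cast hpos'.ne'
  have h1 : ((∑ l ∈ A, y l : ℝ) : ℂ) = y i + ((∑ l ∈ A.erase i, y l : ℝ) : ℂ) := by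
    rw [← Finset.add_sum_erase A y hi]; push_cast; ring
  have h2 := Finset.add_sum_erase A (fun l => (y l : ℂ) * ρ l) hi
  unfold average
  rw [← h2]
  push_cast [-Complex.ofReal_sum]
  rw [h1] at hne ⊢
  field_simp
  ring

/-- A marginal of at most `1 / (D + 1)` means odds of at most `1 / D`. Comparing both erasures with
the full average by the triangle inequality would give `2 * M / D`; the factor `2` is saved by
combining the two displacements. -/
theorem norm_average_erase_sub_le [DecidableEq C] {A : Finset C} {y : C → ℝ} {ρ : C → ℂ}
    {i j : C} (hy : ∀ l ∈ A, 0 ≤ y l) (hpos : 0 < ∑ l ∈ A, y l)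
    {D : ℝ} (hD : 0 < D) (hmarg : ∀ l ∈ A, (D + 1) * y l ≤ ∑ l ∈ A, y l)
    {M : ℝ} (h : ∀ l ∈ A, ∀ m ∈ A, ‖ρ l - ρ m‖ ≤ M) :
    ‖average (A.erase i) y ρ - average (A.erase j) y ρ‖ ≤ M / D := by
  have hM : 0 ≤ M := by
    obtain ⟨m, hm⟩ : A.Nonempty := by
      rw [Finset.nonempty_iff_ne_empty]
      rintro rfl
      simp at hpos
    exact (norm_nonneg _).trans (h m hm m hm)
  have hpos' : ∀ l ∈ A, 0 < ∑ m ∈ A.erase l, y m := by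
    intro l hl
    have h1 := Finset.add_sum_erase A y hl
    have h2 := hmarg l hl
    have h3 := hy l hl
    rcases h3.eq_or_lt with h0 | h0
    · rw [← h0] at h1; linarith
    · nlinarith
  have hodds : ∀ l ∈ A, y l / ∑ m ∈ A.erase l, y m ≤ 1 / D := by
    intro l hl
    rw [div_le_div_iff₀ (hpos' l hl) hD]
    have h1 := Finset.add_sum_erase A y hl
    have h2 := hmarg l hl
    linarith
  have hodds0 : ∀ l ∈ A, 0 ≤ y l / ∑ m ∈ A.erase l, y m := fun l hl =>
    div_nonneg (hy l hl) (hpos' l hl).le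
  have hdev : ∀ l ∈ A, ‖average A y ρ - ρ l‖ ≤ M := fun l hl =>
    norm_average_sub_le hy hpos fun m hm => h m hm l hl
  have hsingle : ∀ l ∈ A, ‖average (A.erase l) y ρ - average A y ρ‖ ≤ M / D := by
    intro l hl
    rw [average_erase_sub ρ hpos hl (hpos' l hl), norm_mul, Complex.norm_real,
      Real.norm_of_nonneg (hodds0 l hl)]
    calc _ ≤ 1 / D * M := mul_le_mul (hodds l hl) (hdev l hl) (norm_nonneg _) (by positivity)
      _ = M / D := by ring
  by_cases hi : i ∈ A
  · by_cases hj : j ∈ A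
    -- With `a ≥ b` the two odds, the common part `b` multiplies only `ρ l - ρ k`, so the total is
    -- at most `(a - b) * M + b * M = a * M`.
    · have key : ∀ a b : ℝ, 0 ≤ b → b ≤ a → a ≤ 1 / D → ∀ k ∈ A, ∀ l ∈ A,
          ‖(a : ℂ) * (average A y ρ - ρ k) - (b : ℂ) * (average A y ρ - ρ l)‖ ≤ M / D := by
        intro a b hb hba ha k hk l hl
        have e : (a : ℂ) * (average A y ρ - ρ k) - (b : ℂ) * (average A y ρ - ρ l) =
            ((a - b : ℝ) : ℂ) * (average A y ρ - ρ k) + (b : ℂ) * (ρ l - ρ k) := by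
          push_cast; ring
        rw [e]
        refine (norm_add_le _ _).trans ?_
        rw [norm_mul, norm_mul, Complex.norm_real, Complex.norm_real,
          Real.norm_of_nonneg hb, Real.norm_of_nonneg (sub_nonneg.2 hba)]
        have h1 := mul_le_mul_of_nonneg_left (hdev k hk) (sub_nonneg.2 hba)
        have h2 := mul_le_mul_of_nonneg_left (h l hl k hk) hb
        have h3 := mul_le_mul_of_nonneg_right ha hM
        have h4 : 1 / D * M = M / D := by ring
        linarith
      have e : average (A.erase i) y ρ - average (A.erase j) y ρ =
          (average (A.erase i) y ρ - average A y ρ) -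
            (average (A.erase j) y ρ - average A y ρ) := by ring
      rw [e, average_erase_sub ρ hpos hi (hpos' i hi), average_erase_sub ρ hpos hj (hpos' j hj)]
      rcases le_total (y j / ∑ m ∈ A.erase j, y m) (y i / ∑ m ∈ A.erase i, y m) with hle | hle
      · exact key _ _ (hodds0 j hj) hle (hodds i hi) i hi j hj
      · rw [norm_sub_rev]
        exact key _ _ (hodds0 i hi) hle (hodds j hj) j hj i hi
    · rw [Finset.erase_eq_of_notMem hj]
      exact hsingle i hi
  · rw [Finset.erase_eq_of_notMem hi]
    by_cases hj : j ∈ A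
    · rw [norm_sub_rev]
      exact hsingle j hj
    · rw [Finset.erase_eq_of_notMem hj, sub_self, norm_zero]
      positivity

/-- The spread is given relative to individual values; since the average has norm at least `(1 - δ)
* ‖ρ m‖`, making it relative to the average costs the factor `1 - δ`. -/
theorem norm_average_erase_div_sub_one_le [DecidableEq C] {A : Finset C} {y : C → ℝ}
    {ρ : C → ℂ} {i j : C} (hy : ∀ l ∈ A, 0 ≤ y l) (hpos : 0 < ∑ l ∈ A, y l)
    {D : ℝ} (hD : 0 < D) (hmarg : ∀ l ∈ A, (D + 1) * y l ≤ ∑ l ∈ A, y l)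
    (hposj : 0 < ∑ l ∈ A.erase j, y l) (hρ : ∀ l ∈ A, ρ l ≠ 0)
    {δ : ℝ} (hδ0 : 0 ≤ δ) (hδ : δ < 1) (h : ∀ l ∈ A, ∀ m ∈ A, ‖ρ l - ρ m‖ ≤ δ * ‖ρ m‖) :
    ‖average (A.erase i) y ρ / average (A.erase j) y ρ - 1‖ ≤ δ / (D * (1 - δ)) := by
  have hy' : ∀ l ∈ A.erase j, 0 ≤ y l := fun l hl => hy l (Finset.mem_of_mem_erase hl)
  have hne : average (A.erase j) y ρ ≠ 0 :=
    average_ne_zero hy' hposj (fun l hl => hρ l (Finset.mem_of_mem_erase hl)) hδ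
      fun l hl m hm => h l (Finset.mem_of_mem_erase hl) m (Finset.mem_of_mem_erase hm)
  have hlow : ∀ m ∈ A, (1 - δ) * ‖ρ m‖ ≤ ‖average (A.erase j) y ρ‖ := by
    intro m hm
    have h1 := norm_average_sub_le hy' hposj fun l hl => h l (Finset.mem_of_mem_erase hl) m hm
    have h2 := norm_sub_norm_le (ρ m) (average (A.erase j) y ρ)
    rw [norm_sub_rev] at h2
    linarith
  have h1δ : 0 < 1 - δ := by linarith
  have hM : ∀ l ∈ A, ∀ m ∈ A,
      ‖ρ l - ρ m‖ ≤ δ * ‖average (A.erase j) y ρ‖ / (1 - δ) := by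
    intro l hl m hm
    rw [le_div_iff₀ h1δ]
    nlinarith [h l hl m hm, mul_le_mul_of_nonneg_left (hlow m hm) hδ0]
  have h3 := norm_average_erase_sub_le (i := i) (j := j) hy hpos hD hmarg hM
  rw [div_sub_one hne, norm_div, div_le_iff₀ (norm_pos_iff.2 hne)]
  refine h3.trans (le_of_eq ?_)
  field_simp

end Averages

/-! ### The induction on the vertex set. -/

section ZeroFree

open scoped Classical

variable {V C : Type*}

/-- Degrees into `S` are at most `Δ`, and each list exceeds the degree by at least `Δ`. -/
def Admissible (G : SimpleGraph V) (Δ : ℕ) (S : Finset V) (L : V → Finset C) : Prop :=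
  ∀ u ∈ S, (nbrs G S u).card ≤ Δ ∧ (nbrs G S u).card + Δ ≤ (L u).card

theorem nbrs_erase (G : SimpleGraph V) (S : Finset V) (u v : V) :
    nbrs G (S.erase v) u = (nbrs G S u).erase v := by
  ext w
  simp [mem_nbrs, and_assoc]

theorem card_nbrs_erase_le (G : SimpleGraph V) (S : Finset V) (u v : V) :
    (nbrs G (S.erase v) u).card ≤ (nbrs G S u).card := by
  rw [nbrs_erase]
  exact Finset.card_le_card (Finset.erase_subset _ _)

theorem card_nbrs_erase_add_one (G : SimpleGraph V) {S : Finset V} {u v : V} (hv : v ∈ S)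
    (h : G.Adj u v) : (nbrs G (S.erase v) u).card + 1 = (nbrs G S u).card := by
  rw [nbrs_erase]
  exact Finset.card_erase_add_one (mem_nbrs.2 ⟨hv, h⟩)

theorem Admissible.erase {G : SimpleGraph V} {Δ : ℕ} {S : Finset V} {L : V → Finset C}
    (h : Admissible G Δ S L) (v : V) : Admissible G Δ (S.erase v) L := fun u hu => by
  have h1 := h u (Finset.mem_of_mem_erase hu)
  have h2 := card_nbrs_erase_le G S u v
  omega

theorem card_le_card_eraseOn_add_one (T : Finset V) (c : C) (L : V → Finset C) (u : V) :
    (L u).card ≤ (eraseOn T c L u).card + 1 := by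
  unfold eraseOn
  split_ifs
  · have := Finset.pred_card_le_card_erase (s := L u) (a := c)
    omega
  · omega

theorem Admissible.eraseOn {G : SimpleGraph V} {Δ : ℕ} {S T : Finset V} {L : V → Finset C}
    (h : Admissible G Δ S L) (c : C)
    (hT : ∀ u ∈ S, u ∈ T → (nbrs G S u).card + 1 + Δ ≤ (L u).card) :
    Admissible G Δ S (eraseOn T c L) := fun u hu => by
  refine ⟨(h u hu).1, ?_⟩
  by_cases huT : u ∈ T
  · have h1 := hT u hu huT
    have h2 := card_le_card_eraseOn_add_one T c L u
    omega
  · rw [ColoringModel.eraseOn, if_neg huT]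
    exact (h u hu).2

/-- Each neighbor of `v` loses at most one color and exactly one neighbor, so its surplus of colors
over degree is kept. -/
theorem Admissible.eraseOn_nbrs {G : SimpleGraph V} {Δ : ℕ} {S : Finset V} {L : V → Finset C}
    (h : Admissible G Δ S L) {v : V} (hv : v ∈ S) (c : C) :
    Admissible G Δ (S.erase v) (ColoringModel.eraseOn (nbrs G S v) c L) := by
  refine (h.erase v).eraseOn c fun u _ huN => ?_
  have h1 := (h u (mem_nbrs.1 huN).1).2
  rw [card_nbrs_erase_add_one G hv (mem_nbrs.1 huN).2.symm]
  exact h1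

variable [Fintype V] [Fintype C] [Inhabited C]

theorem listColorings_congr (G : SimpleGraph V) {S : Finset V} {L L' : V → Finset C}
    (h : ∀ v ∈ S, L v = L' v) : listColorings G S L = listColorings G S L' := by
  ext σ
  rw [mem_listColorings, mem_listColorings]
  refine and_congr_left fun _ => forall₂_congr fun v hv => ?_
  rw [h v hv]

/-- The list of `u` is irrelevant once `u` is colored. Hence erasing a color at `u` changes only the
index set of the average, not its weights or values. -/
theorem listColorings_eraseOn_singleton (G : SimpleGraph V) {S : Finset V} {u : V}
    (c i : C) (L : V → Finset C) (N : Finset V) :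
    listColorings G (S.erase u) (eraseOn N c (eraseOn {u} i L)) =
      listColorings G (S.erase u) (eraseOn N c L) := by
  refine listColorings_congr G fun v hv => ?_
  simp [eraseOn, Finset.ne_of_mem_erase hv]

/-- The partition function relative to its value without external fields. -/
noncomputable def ratio (G : SimpleGraph V) (lam : C → ℂ) (S : Finset V) (L : V → Finset C) : ℂ :=
  listSum G lam S L / (listCount G S L : ℂ)

theorem Admissible.listCount_pos {G : SimpleGraph V} {Δ : ℕ} (hΔ : 1 ≤ Δ) {S : Finset V} :
    ∀ {L : V → Finset C}, Admissible G Δ S L → 0 < listCount G S L := by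
  induction S using Finset.strongInduction with
  | H S ih =>
    intro L h
    rcases S.eq_empty_or_nonempty with rfl | ⟨u, hu⟩
    · have h1 := listSum_empty G (fun _ : C => (1 : ℕ)) L
      rw [listSum_one, Nat.cast_id] at h1
      omega
    · have h1 := ih (S.erase u) (Finset.erase_ssubset hu) (h.erase u)
      have h2 := mul_listCount_erase_le G hu L (h u hu).2
      nlinarith

/-- The ratio is an average of the ratios after assigning a color to `u`. -/
theorem ratio_eraseOn_eq_average (G : SimpleGraph V) (lam : C → ℂ) {S : Finset V} {u : V}
    (hu : u ∈ S) (L : V → Finset C)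
    (hpos : ∀ c ∈ L u, 0 < listCount G (S.erase u) (eraseOn (nbrs G S u) c L)) (i : C) :
    ratio G lam S (eraseOn {u} i L) = average ((L u).erase i)
      (fun c => (listCount G (S.erase u) (eraseOn (nbrs G S u) c L) : ℝ))
      (fun c => lam c * ratio G lam (S.erase u) (eraseOn (nbrs G S u) c L)) := by
  have e : eraseOn {u} i L u = (L u).erase i := by simp [eraseOn]
  unfold ratio average
  rw [listSum_eq_sum_erase G lam hu, listCount_eq_sum_erase G hu, e]
  unfold listSum listCount
  simp_rw [listColorings_eraseOn_singleton]
  congr 1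
  · refine Finset.sum_congr rfl fun c hc => ?_
    have : ((listColorings G (S.erase u) (eraseOn (nbrs G S u) c L)).card : ℂ) ≠ 0 := by
      exact_mod_cast (hpos c (Finset.mem_of_mem_erase hc)).ne'
    push_cast
    field_simp
  · push_cast
    rfl

theorem ratio_eq_average (G : SimpleGraph V) (lam : C → ℂ) {S : Finset V} {u : V}
    (hu : u ∈ S) (L : V → Finset C)
    (hpos : ∀ c ∈ L u, 0 < listCount G (S.erase u) (eraseOn (nbrs G S u) c L)) :
    ratio G lam S L = average (L u)
      (fun c => (listCount G (S.erase u) (eraseOn (nbrs G S u) c L) : ℝ))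
      (fun c => lam c * ratio G lam (S.erase u) (eraseOn (nbrs G S u) c L)) := by
  unfold ratio average
  rw [listSum_eq_sum_erase G lam hu, listCount_eq_sum_erase G hu]
  congr 1
  · refine Finset.sum_congr rfl fun c hc => ?_
    have : (listCount G (S.erase u) (eraseOn (nbrs G S u) c L) : ℂ) ≠ 0 := by
      exact_mod_cast (hpos c hc).ne'
    push_cast
    field_simp
  · push_cast
    rfl

/-- The induction hypothesis: the partition functions of admissible instances do not vanish, and
exchanging the color removed from one list changes the ratio by a factor close to `1`. -/
def Stable (G : SimpleGraph V) (lam : C → ℂ) (Δ : ℕ) (ε : ℝ) (S : Finset V) : Prop :=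
  ∀ L : V → Finset C, Admissible G Δ S L → ratio G lam S L ≠ 0 ∧
    ∀ u ∈ S, (nbrs G S u).card + 1 + Δ ≤ (L u).card → (nbrs G S u).card + 1 ≤ Δ → ∀ i j : C,
      ‖ratio G lam S (eraseOn {u} i L) / ratio G lam S (eraseOn {u} j L) - 1‖ ≤ Real.exp ε - 1

/-- Telescoping: the lists of `T` are switched from `j` to `i` one vertex at a time, each switch
costing `ε`. -/
theorem Stable.norm_ratio_eraseOn_div_sub_one_le {G : SimpleGraph V} {lam : C → ℂ} {Δ : ℕ} {ε : ℝ}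
    {S : Finset V} (hS : Stable G lam Δ ε S) (i j : C) (T : Finset V) :
    T ⊆ S → ∀ L : V → Finset C, Admissible G Δ S L →
      (∀ u ∈ T, (nbrs G S u).card + 1 + Δ ≤ (L u).card ∧ (nbrs G S u).card + 1 ≤ Δ) →
      ‖ratio G lam S (eraseOn T i L) / ratio G lam S (eraseOn T j L) - 1‖ ≤
        Real.exp (T.card * ε) - 1 := by
  induction T using Finset.induction_on with
  | empty =>
    intro _ L hL _
    have e : ∀ c : C, eraseOn (∅ : Finset V) c L = L := fun c => by
      funext v; simp [eraseOn]
    rw [e, e, div_self (hS L hL).1]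
    simp
  | insert u T huT ih =>
    intro hTS L hL hT
    have huS : u ∈ S := hTS (Finset.mem_insert_self _ _)
    have hu := hT u (Finset.mem_insert_self _ _)
    have hLu : Admissible G Δ S (eraseOn {u} j L) := hL.eraseOn j fun w _ hw => by
      rw [Finset.mem_singleton.1 hw]; exact hu.1
    have hLT : Admissible G Δ S (eraseOn T i L) := hL.eraseOn i fun w _ hw =>
      (hT w (Finset.mem_insert_of_mem hw)).1
    have huL : eraseOn T i L u = L u := by simp [eraseOn, huT]
    have h1 := ih (fun w hw => hTS (Finset.mem_insert_of_mem hw)) _ hLu fun w hw => by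
      have hwu : w ≠ u := fun h => huT (h ▸ hw)
      have : eraseOn {u} j L w = L w := by simp [eraseOn, hwu]
      rw [this]
      exact hT w (Finset.mem_insert_of_mem hw)
    have h2 := (hS _ hLT).2 u huS (by rw [huL]; exact hu.1) hu.2 i j
    -- The intermediate instance, with `i` erased on `T` and `j` at `u`, cancels in the product of
    -- the two quotients.
    have hmid : ratio G lam S (eraseOn {u} j (eraseOn T i L)) ≠ 0 :=
      (hS _ (hLT.eraseOn j fun w _ hw => by
        rw [Finset.mem_singleton.1 hw, huL]; exact hu.1)).1
    have h3 := norm_mul_sub_one_le h2 h1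
    rw [eraseOn_comm T {u} i j, div_mul_div_cancel₀ hmid, eraseOn_comm T {u} j j,
      ← eraseOn_insert, ← eraseOn_insert] at h3
    rw [Finset.card_insert_of_notMem huT]
    convert h3 using 3
    push_cast
    ring

theorem Stable.norm_sub_le {G : SimpleGraph V} {lam : C → ℂ} {Δ : ℕ} {ε κ : ℝ}
    (hlam : ∀ c, lam c ≠ 0) (hκ : ∀ c c', ‖lam c / lam c' - 1‖ ≤ Real.exp κ - 1)
    {S : Finset V} {u : V} (hu : u ∈ S) (hS : Stable G lam Δ ε (S.erase u)) {L : V → Finset C}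
    (hL : Admissible G Δ S L) (l m : C) :
    ‖lam l * ratio G lam (S.erase u) (eraseOn (nbrs G S u) l L) -
        lam m * ratio G lam (S.erase u) (eraseOn (nbrs G S u) m L)‖ ≤
      (Real.exp (κ + (nbrs G S u).card * ε) - 1) *
        ‖lam m * ratio G lam (S.erase u) (eraseOn (nbrs G S u) m L)‖ := by
  have h1 := hS.norm_ratio_eraseOn_div_sub_one_le l m (nbrs G S u) (nbrs_subset_erase G S u) L
    (hL.erase u) fun w hw => by
      obtain ⟨hwS, hw⟩ := mem_nbrs.1 hw
      -- Removing `u` lowers the degree of its neighbor `w` by one, which supplies both the spare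
      -- color and the bound `Δ - 1` on the degree.
      rw [card_nbrs_erase_add_one G hu hw.symm]
      exact (hL w hwS).symm
  have h2 := norm_mul_sub_one_le (hκ l m) h1
  have h3 : lam m * ratio G lam (S.erase u) (eraseOn (nbrs G S u) m L) ≠ 0 :=
    mul_ne_zero (hlam m) (hS _ (hL.eraseOn_nbrs hu m)).1
  rwa [div_mul_div_comm, div_sub_one h3, norm_div, div_le_iff₀ (norm_pos_iff.2 h3)] at h2

theorem contraction_bound {Δ : ℕ} (hΔ : 1 ≤ Δ) {d : ℕ} (hd : d + 1 ≤ Δ) :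
    Real.exp (1 / (200 * (Δ : ℝ) ^ 2) + d * (1 / (100 * (Δ : ℝ) ^ 2))) - 1 < 1 ∧
    (Real.exp (1 / (200 * (Δ : ℝ) ^ 2) + d * (1 / (100 * (Δ : ℝ) ^ 2))) - 1) /
      (Δ * (1 - (Real.exp (1 / (200 * (Δ : ℝ) ^ 2) + d * (1 / (100 * (Δ : ℝ) ^ 2))) - 1))) ≤
      Real.exp (1 / (100 * (Δ : ℝ) ^ 2)) - 1 := by
  have hΔ' : (1 : ℝ) ≤ Δ := by exact_mod_cast hΔ
  have hd' : (d : ℝ) + 1 ≤ Δ := by exact_mod_cast hd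
  -- In terms of `h`, `ε = 100 h²`, `κ = 50 h²` and `Δ ε = h`. The exponent is thus at most `h - 50
  -- h²`, and `exp x - 1 ≤ x + x²` gives `δ ≤ h - 49 h²`, while the contraction only needs `δ * (1 +
  -- h) ≤ h`.
  obtain ⟨h, hh⟩ : ∃ h : ℝ, h = 1 / (100 * Δ) := ⟨_, rfl⟩
  have h0 : 0 < h := by rw [hh]; positivity
  have h1 : h ≤ 1 / 100 := by
    rw [hh]
    exact one_div_le_one_div_of_le (by norm_num) (by linarith)
  have hε : 1 / (100 * (Δ : ℝ) ^ 2) = 100 * h ^ 2 := by rw [hh]; field_simp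
  have hκ : 1 / (200 * (Δ : ℝ) ^ 2) = 50 * h ^ 2 := by rw [hh]; field_simp; norm_num
  have hΔh : (Δ : ℝ) * h = 1 / 100 := by rw [hh]; field_simp
  rw [hε, hκ]
  set x := 50 * h ^ 2 + d * (100 * h ^ 2) with hx
  have hx0 : 0 ≤ x := by positivity
  have hx1 : x ≤ h - 50 * h ^ 2 := by
    have := mul_le_mul_of_nonneg_right hd' (by positivity : 0 ≤ 100 * h ^ 2)
    have e : (Δ : ℝ) * (100 * h ^ 2) = h := by
      calc (Δ : ℝ) * (100 * h ^ 2) = 100 * h * (Δ * h) := by ring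
        _ = h := by rw [hΔh]; ring
    linarith
  have hexp := Real.abs_exp_sub_one_sub_id_le (x := x) (by rw [abs_of_nonneg hx0]; nlinarith)
  have hδ : Real.exp x - 1 ≤ h - 49 * h ^ 2 := by
    have h2 := (abs_le.1 hexp).2
    nlinarith
  have hδ0 : 0 ≤ Real.exp x - 1 := by linarith [Real.add_one_le_exp x]
  have hδ1 : Real.exp x - 1 < 1 := by nlinarith
  refine ⟨hδ1, ?_⟩
  have h3 := Real.add_one_le_exp (100 * h ^ 2)
  refine le_trans ?_ (by linarith : 100 * h ^ 2 ≤ Real.exp (100 * h ^ 2) - 1)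
  rw [div_le_iff₀ (by nlinarith)]
  have e : 100 * h ^ 2 * (Δ * (1 - (Real.exp x - 1))) = h * (1 - (Real.exp x - 1)) := by
    calc _ = 100 * h * (Δ * h) * (1 - (Real.exp x - 1)) := by ring
      _ = _ := by rw [hΔh]; ring
  rw [e]
  nlinarith [mul_le_mul_of_nonneg_right hδ (by linarith : 0 ≤ 1 + h)]

/-- For nonvanishing the degree may be the full `Δ`, where only `δ < 1` is needed and no
contraction. -/
theorem exp_bound_lt_one {Δ : ℕ} (hΔ : 1 ≤ Δ) {d : ℕ} (hd : d ≤ Δ) :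
    Real.exp (1 / (200 * (Δ : ℝ) ^ 2) + d * (1 / (100 * (Δ : ℝ) ^ 2))) - 1 < 1 := by
  have hΔ' : (1 : ℝ) ≤ Δ := by exact_mod_cast hΔ
  have hd' : (d : ℝ) ≤ Δ := by exact_mod_cast hd
  have hx0 : 0 ≤ 1 / (200 * (Δ : ℝ) ^ 2) + d * (1 / (100 * (Δ : ℝ) ^ 2)) := by positivity
  have hx1 : 1 / (200 * (Δ : ℝ) ^ 2) + d * (1 / (100 * (Δ : ℝ) ^ 2)) ≤ 1 / 10 := by
    have e : 1 / (200 * (Δ : ℝ) ^ 2) + d * (1 / (100 * (Δ : ℝ) ^ 2)) =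
        (1 + 2 * d) / (200 * (Δ : ℝ) ^ 2) := by field_simp; ring
    rw [e, div_le_iff₀ (by positivity)]
    nlinarith
  have hexp := Real.abs_exp_sub_one_sub_id_le
    (x := 1 / (200 * (Δ : ℝ) ^ 2) + d * (1 / (100 * (Δ : ℝ) ^ 2)))
    (by rw [abs_of_nonneg hx0]; linarith)
  have h2 := (abs_le.1 hexp).2
  nlinarith

theorem stable_of_forall_erase {G : SimpleGraph V} {lam : C → ℂ} {Δ : ℕ} (hΔ : 1 ≤ Δ)
    (hlam : ∀ c, lam c ≠ 0)
    (hκ : ∀ c c', ‖lam c / lam c' - 1‖ ≤ Real.exp (1 / (200 * (Δ : ℝ) ^ 2)) - 1)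
    {S : Finset V} (hne : S.Nonempty)
    (hS : ∀ u ∈ S, Stable G lam Δ (1 / (100 * (Δ : ℝ) ^ 2)) (S.erase u)) :
    Stable G lam Δ (1 / (100 * (Δ : ℝ) ^ 2)) S := by
  intro L hL
  have hcount : ∀ u ∈ S, ∀ c, 0 < listCount G (S.erase u) (eraseOn (nbrs G S u) c L) :=
    fun u hu c => (hL.eraseOn_nbrs hu c).listCount_pos hΔ
  have hρ : ∀ u ∈ S, ∀ c, lam c * ratio G lam (S.erase u) (eraseOn (nbrs G S u) c L) ≠ 0 :=
    fun u hu c => mul_ne_zero (hlam c) (hS u hu _ (hL.eraseOn_nbrs hu c)).1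
  have hsum : ∀ u ∈ S, ∑ c ∈ L u,
      (listCount G (S.erase u) (eraseOn (nbrs G S u) c L) : ℝ) = listCount G S L :=
    fun u hu => by rw [listCount_eq_sum_erase G hu]; push_cast; rfl
  have hpos : (0 : ℝ) < listCount G S L := by exact_mod_cast hL.listCount_pos hΔ
  constructor
  · obtain ⟨u, hu⟩ := hne
    rw [ratio_eq_average G lam hu L fun c _ => hcount u hu c]
    exact average_ne_zero (fun l _ => Nat.cast_nonneg _) (by rw [hsum u hu]; exact hpos)
      (fun l _ => hρ u hu l) (exp_bound_lt_one hΔ (hL u hu).1)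
      fun l _ m _ => (hS u hu).norm_sub_le hlam hκ hu hL l m
  · intro u hu hcard hdeg i j
    obtain ⟨hδ1, hδ⟩ := contraction_bound hΔ hdeg
    rw [ratio_eraseOn_eq_average G lam hu L fun c _ => hcount u hu c,
      ratio_eraseOn_eq_average G lam hu L fun c _ => hcount u hu c]
    refine (norm_average_erase_div_sub_one_le (fun l _ => Nat.cast_nonneg _)
      (by rw [hsum u hu]; exact hpos) (by exact_mod_cast hΔ) ?_ ?_ (fun l _ => hρ u hu l) ?_ hδ1
      fun l _ m _ => (hS u hu).norm_sub_le hlam hκ hu hL l m).trans hδ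
    · intro l _
      rw [hsum u hu]
      -- The spare color at `u` allows `Δ + 1` in place of `Δ`, hence odds of at most `1 / Δ`.
      have h1 := mul_listCount_erase_le G hu L (m := Δ + 1) (by omega)
      have h2 := Nat.mul_le_mul_left (Δ + 1)
        (listCount_eraseOn_le G (nbrs_subset_erase G S u) l L)
      exact_mod_cast h2.trans h1
    · refine Finset.sum_pos (fun l _ => by exact_mod_cast hcount u hu l) ?_
      rw [← Finset.card_pos]
      have := Finset.pred_card_le_card_erase (s := L u) (a := j)
      omega
    · have : 0 ≤ 1 / (200 * (Δ : ℝ) ^ 2) + (nbrs G S u).card * (1 / (100 * (Δ : ℝ) ^ 2)) := by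
        positivity
      linarith [Real.add_one_le_exp
        (1 / (200 * (Δ : ℝ) ^ 2) + (nbrs G S u).card * (1 / (100 * (Δ : ℝ) ^ 2)))]

theorem stable {G : SimpleGraph V} {lam : C → ℂ} {Δ : ℕ} (hΔ : 1 ≤ Δ)
    (hlam : ∀ c, lam c ≠ 0)
    (hκ : ∀ c c', ‖lam c / lam c' - 1‖ ≤ Real.exp (1 / (200 * (Δ : ℝ) ^ 2)) - 1)
    (S : Finset V) : Stable G lam Δ (1 / (100 * (Δ : ℝ) ^ 2)) S := by
  induction S using Finset.strongInduction with
  | H S ih =>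
    rcases S.eq_empty_or_nonempty with rfl | hne
    · intro L hL
      refine ⟨div_ne_zero ?_ ?_, fun u hu => absurd hu (Finset.notMem_empty u)⟩
      · rw [listSum_empty]; exact one_ne_zero
      · exact_mod_cast (hL.listCount_pos hΔ).ne'
    · exact stable_of_forall_erase hΔ hlam hκ hne fun u hu => ih _ (Finset.erase_ssubset hu)

end ZeroFree

/-! ### Application to the polydisc around `1`. -/

theorem partitionFunction_eq_listSum {V : Type*} [Fintype V] (G : SimpleGraph V) {n : ℕ}
    (lam : Fin (n + 1) → ℂ) :
    partitionFunction G lam = listSum G lam Finset.univ fun _ => Finset.univ := by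
  classical
  unfold partitionFunction listSum
  refine Finset.sum_congr ?_ fun σ _ => ?_
  · ext σ
    simp [mem_listColorings]
  · rw [← Finset.prod_fiberwise (s := Finset.univ) (g := σ)]
    refine Finset.prod_congr rfl fun i _ => ?_
    rw [Finset.prod_congr rfl (g := fun _ => lam i)
      fun v hv => by rw [(Finset.mem_filter.1 hv).2], Finset.prod_const]

/-- The induction needs a radius of order `Δ⁻²` only. -/
theorem zeroFreeRadius_le {Δ : ℕ} (hΔ : 1 ≤ Δ) :
    zeroFreeRadius Δ ≤ 1 / (1000 * (Δ : ℝ) ^ 2) := by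
  have hΔ' : (1 : ℝ) ≤ (Δ : ℝ) ^ 2 := one_le_pow₀ (by exact_mod_cast hΔ)
  have e : zeroFreeRadius Δ = 9 / (400000 * ((Δ : ℝ) ^ 2 * (Δ : ℝ) ^ 2)) := by
    unfold zeroFreeRadius nu epsI
    field_simp
    norm_num
  rw [e, div_le_div_iff₀ (by positivity) (by positivity)]
  nlinarith

theorem one_sub_le_norm {z : ℂ} {R : ℝ} (h : ‖z - 1‖ ≤ R) : 1 - R ≤ ‖z‖ := by
  have := norm_sub_norm_le (1 : ℂ) z
  rw [norm_sub_rev, norm_one] at this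
  linarith

theorem norm_div_sub_one_le {z w : ℂ} {R : ℝ} (hR : R < 1) (hz : ‖z - 1‖ ≤ R)
    (hw : ‖w - 1‖ ≤ R) : ‖z / w - 1‖ ≤ 2 * R / (1 - R) := by
  have h1 := one_sub_le_norm hw
  have hw0 : 0 < ‖w‖ := by linarith
  have hR0 : 0 ≤ R := (norm_nonneg _).trans hz
  have h2 : ‖z - w‖ ≤ 2 * R := by
    have := norm_sub_le (z - 1) (w - 1)
    rw [sub_sub_sub_cancel_right] at this
    linarith
  rw [div_sub_one (norm_pos_iff.1 hw0), norm_div]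
  exact div_le_div₀ (by linarith) h2 (by linarith) h1

theorem partitionFunction_ne_zero {Δ q : ℕ} (hΔ : 1 ≤ Δ) (hq : 2 * Δ ≤ q) {R : ℝ}
    (hR : R ≤ zeroFreeRadius Δ) {V : Type*} [Fintype V] (G : SimpleGraph V) [DecidableRel G.Adj]
    (hG : G.maxDegree ≤ Δ) {lam : Fin q → ℂ} (hlam : ∀ i, ‖lam i - 1‖ ≤ R) :
    partitionFunction G lam ≠ 0 := by
  obtain ⟨n, rfl⟩ : ∃ n, q = n + 1 := ⟨q - 1, by omega⟩
  have hΔ' : (1 : ℝ) ≤ (Δ : ℝ) ^ 2 := one_le_pow₀ (by exact_mod_cast hΔ)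
  have hR1 := hR.trans (zeroFreeRadius_le hΔ)
  have hR2 : R ≤ 1 / 1000 :=
    hR1.trans (one_div_le_one_div_of_le (by norm_num) (by linarith))
  have hR0 : 0 ≤ R := (norm_nonneg _).trans (hlam 0)
  have hne : ∀ c, lam c ≠ 0 := fun c => norm_pos_iff.1 <| by
    have := one_sub_le_norm (hlam c)
    linarith
  have hκ : ∀ c c', ‖lam c / lam c' - 1‖ ≤ Real.exp (1 / (200 * (Δ : ℝ) ^ 2)) - 1 := by
    intro c c'
    refine (norm_div_sub_one_le (by linarith) (hlam c) (hlam c')).trans ?_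
    have h1 := Real.add_one_le_exp (1 / (200 * (Δ : ℝ) ^ 2))
    have h2 : 1 / (200 * (Δ : ℝ) ^ 2) = 5 * (1 / (1000 * (Δ : ℝ) ^ 2)) := by
      field_simp; norm_num
    -- The quotient bound `2 * R / (1 - R)` is below `5 * R`, and `5 / (1000 Δ²)` is exactly `κ`.
    refine le_trans ?_ (by linarith : 5 * R ≤ _)
    rw [div_le_iff₀ (by linarith)]
    nlinarith
  have hadm : Admissible G Δ Finset.univ fun _ => (Finset.univ : Finset (Fin (n + 1))) := by
    intro u _
    have h1 : (nbrs G Finset.univ u).card = G.degree u := by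
      rw [← SimpleGraph.card_neighborFinset_eq_degree]
      congr 1
      ext w
      simp [mem_nbrs]
    have h2 := G.degree_le_maxDegree u
    have h3 : (Finset.univ : Finset (Fin (n + 1))).card = n + 1 := by simp
    change _ ∧ _ ≤ (Finset.univ : Finset (Fin (n + 1))).card
    omega
  have h := (stable hΔ hne hκ Finset.univ _ hadm).1
  rw [partitionFunction_eq_listSum]
  intro h0
  exact h (by rw [ratio, h0, zero_div])

theorem norm_log_le_of_norm_sub_one_le {z : ℂ} {R : ℝ} (hR : R ≤ 1 / 2) (hz : ‖z - 1‖ ≤ R) :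
    ‖Complex.log z‖ ≤ 2 * R := by
  have h := Complex.norm_log_one_add_half_le_self (hz.trans hR)
  rw [add_sub_cancel] at h
  linarith [norm_nonneg (z - 1)]

theorem isValid_of_norm_sub_one_le {Δ q : ℕ} (hΔ : 1 ≤ Δ) {R : ℝ}
    (hR : R ≤ zeroFreeRadius Δ) {lam : Fin q → ℂ} (hlam : ∀ i, ‖lam i - 1‖ ≤ R) :
    IsValid Δ lam := by
  have hΔ' : (1 : ℝ) ≤ Δ := by exact_mod_cast hΔ
  have hε : 0 < epsI Δ := by unfold epsI; positivity
  have hR2 : R ≤ 1 / 2 := (hR.trans (zeroFreeRadius_le hΔ)).trans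
    (one_div_le_one_div_of_le (by norm_num) (by nlinarith))
  -- Each logarithm has norm at most `2 * R`: this is half of `nu * epsI Δ` for an argument, and two
  -- logarithms together stay below `epsI Δ ≤ Δ * epsI Δ`.
  have hRε : 4 * R ≤ nu * epsI Δ := by unfold zeroFreeRadius at hR; linarith
  refine ⟨fun i => ?_, fun i => ?_, fun i j => ?_⟩
  · have := (Complex.abs_re_le_norm (lam i - 1)).trans (hlam i)
    rw [Complex.sub_re, Complex.one_re] at this
    exact Or.inl (by linarith [(abs_le.1 this).1])
  · have h1 := norm_log_le_of_norm_sub_one_le hR2 (hlam i)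
    have h2 := Complex.abs_im_le_norm (Complex.log (lam i))
    rw [Complex.log_im] at h2
    linarith
  · have hpos : ∀ k, ‖lam k‖ ≠ 0 := fun k => ne_of_gt <| by
      linarith [one_sub_le_norm (hlam k)]
    rw [Complex.log_re, norm_div, Real.log_div (hpos i) (hpos j), ← Complex.log_re,
      ← Complex.log_re, ← Complex.sub_re]
    have h1 := norm_log_le_of_norm_sub_one_le hR2 (hlam i)
    have h2 := norm_log_le_of_norm_sub_one_le hR2 (hlam j)
    have h3 := norm_sub_le (Complex.log (lam i)) (Complex.log (lam j))
    have h4 := Complex.abs_re_le_norm (Complex.log (lam i) - Complex.log (lam j))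
    unfold nu at hRε
    nlinarith

end ColoringModel

theorem mainTheorem2 (Δ q : ℕ) (hΔ : 1 ≤ Δ) (R : ℝ) (hR : 0 < R)
    (hRle : R ≤ ColoringModel.zeroFreeRadius Δ) :
    (∀ lam : Fin q → ℂ, (∀ i, ‖lam i - 1‖ ≤ R) → ColoringModel.IsValid Δ lam) ∧
    (2 * Δ ≤ q →
      ∀ (V : Type*) [Fintype V] (G : SimpleGraph V) [DecidableRel G.Adj], G.maxDegree ≤ Δ →
        ∀ lam : Fin q → ℂ, (∀ i, ‖lam i - 1‖ ≤ R) →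
          ColoringModel.partitionFunction G lam ≠ 0) :=
  ⟨fun _ hlam => ColoringModel.isValid_of_norm_sub_one_le hΔ hRle hlam,
    fun hq _ _ G _ hG _ hlam =>
      ColoringModel.partitionFunction_ne_zero hΔ hq hRle G hG hlam⟩
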